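/- Let $n,s$ be integers with $0\le s\le n$. For integers $m\ge 0$ and $i\ge 0$ let $\mathcal P(m,i)$ be the set of partitions of $m$ into exactly $i$ (positive) parts. For partitions $p,q$ of $n$ write $p\le q$ if $p$ can be obtained from $q$ by summing some of the parts of $q$ and reordering. A monic real polynomial is called hyperbolic if all its roots are real; for a monic hyperbolic polynomial $G$ of degree $n$ let $p(G)$ be the partition of $n$ formed by the multiplicities of its distinct roots. For a monic hyperbolic polynomial $F=T^n+F_1T^{n-1}+\dots+F_n$ let the hyperbolic slice $\mathcal H_s(F)$ be the set of all monic hyperbolic polynomials $T^n+H_1T^{n-1}+\dots+H_n$ with $H_i=F_i$ for $1\le i\le s$. A set $P\subseteq\mathcal P(n,s)$ is an $(n,s)$-Vandermonde covering if for every monic hyperbolic polynomial $F$ of degree $n$ there are $q\in P$ and $G\in\mathcal H_s(F)$ with $p(G)\le q$. Theorem. Every $(n,s)$-Vandermonde covering $P$ satisfies $$|P|\;\ge\;\sum_{i=0}^{\lfloor s/2\rfloor}B_i,$$ where $B_0=0$, $B_1=1$ and $$B_i=\left\lceil \frac{2\bigl(|\mathcal P(n-s+1,i)|-iB_{i-1}-B_{i-2}\bigr)}{i^2+i}\right\rceil\qquad\text{for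 } i\ge 2 .$$ -/

import Mathlib

open Polynomial

namespace VandermondeCovering

/-- The monic hyperbolic polynomials of degree `n`: monic real polynomials of degree `n`
all of whose roots are real. -/
def hyperbolic (n : ℕ) : Set ℝ[X] :=
  {F | F.Monic ∧ F.natDegree = n ∧ F.Splits}

/-- For `F = T ^ n + F₁ T ^ (n - 1) + ⋯ + Fₙ`, the hyperbolic slice `ℋ_s(F)` of all monic
hyperbolic polynomials `T ^ n + H₁ T ^ (n - 1) + ⋯ + Hₙ` with `Hᵢ = Fᵢ` for `1 ≤ i ≤ s`
(where `s ≤ n`). -/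
def hyperbolicSlice (n s : ℕ) (F : ℝ[X]) : Set ℝ[X] :=
  {H | H ∈ hyperbolic n ∧ ∀ i ∈ Finset.Icc 1 s, H.coeff (n - i) = F.coeff (n - i)}

theorem card_roots_of_mem_hyperbolic {n : ℕ} {G : ℝ[X]} (hG : G ∈ hyperbolic n) :
    Multiset.card G.roots = n := by
  rw [← hG.2.1]
  exact hG.2.2.natDegree_eq_card_roots.symm

/-- The partition `p(G)` of `n` formed by the multiplicities of the distinct roots of a monic
hyperbolic polynomial `G` of degree `n`. -/
noncomputable def rootPartition {n : ℕ} (G : ℝ[X]) (hG : G ∈ hyperbolic n) : n.Partition :=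
  Nat.Partition.ofSym (⟨G.roots, card_roots_of_mem_hyperbolic hG⟩ : Sym ℝ n)

/-- `MergeLE p q` is the order `p ≤ q` on partitions of `n`: `p` is obtained from `q` by summing
some of the parts, i.e. the multiset of parts of `q` can be split into blocks whose sums are the
parts of `p`. (The blocks are nonempty because parts of `p` are positive.) -/
def MergeLE {n : ℕ} (p q : n.Partition) : Prop :=
  ∃ blocks : Multiset (Multiset ℕ),
    blocks.join = q.parts ∧ blocks.map Multiset.sum = p.parts

/-- The set `𝒫(n, s)` of partitions of `n` into exactly `s` parts. -/
def partitionsInto (n s : ℕ) : Finset n.Partition :=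
  Finset.univ.filter fun p => Multiset.card p.parts = s

/-- `P ⊆ 𝒫(n, s)` is an `(n, s)`-Vandermonde covering if every hyperbolic slice `ℋ_s(F)`
contains some `G` with `p(G) ≤ q` for some `q ∈ P`. -/
def IsVandermondeCovering (n s : ℕ) (P : Finset n.Partition) : Prop :=
  P ⊆ partitionsInto n s ∧
    ∀ F ∈ hyperbolic n, ∃ q ∈ P, ∃ (G : ℝ[X]) (hG : G ∈ hyperbolicSlice n s F),
      MergeLE (rootPartition G hG.1) q

/-- The integers `B_i` of the recursive bound, for given `n` and `s ≤ n`. -/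
def B (n s : ℕ) : ℕ → ℤ
  | 0 => 0
  | 1 => 1
  | i + 2 =>
      ⌈(2 * (((partitionsInto (n - s + 1) (i + 2)).card : ℚ)
          - ((i + 2 : ℕ) : ℚ) * (B n s (i + 1) : ℚ) - (B n s i : ℚ)))
        / (((i + 2 : ℕ) : ℚ) ^ 2 + ((i + 2 : ℕ) : ℚ))⌉

end VandermondeCovering

/-! Suppose `F` has `s - 1` distinct roots, every second one of which (the second, the fourth, …) is
simple. Then `ℋ_s(F) = {F}`: list the roots of some `H ∈ ℋ_s(F)` and of `F` in increasing order. A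
polynomial of degree at most `s - 1` that vanishes at the remaining roots of `F` and at one
well-chosen point near each simple root changes sign in such a way that its antiderivative `g`
cannot decrease when a root of `F` is moved to the corresponding root of `H`. Since `deg g ≤ s`,
Newton's identities give `g` the same sum over both lists, so the lists agree.

Consequently every partition of `n` into `s - 1` parts, at most `s / 2` of which exceed one, arises
by adding two parts of some `q ∈ P`. Subtracting one from each part identifies those with exactly
`i` parts exceeding one with `𝒫(n - s + 1, i)`. If `x j` is the number of `q ∈ P` with `j` parts
exceeding one, then
`|𝒫(n - s + 1, i)| ≤ (i + 1).choose 2 * x (i + 1) + i * x i + x (i - 1)`,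
because the two parts added both exceed one, or exactly one does, or neither does. Summing these
inequalities by parts turns them into the recursion for `B`. -/

namespace VandermondeCovering

theorem sum_pow_eq_of_esymm_eq {ι R : Type*} [Fintype ι] [CommRing R] {s : ℕ} {x y : ι → R}
    (h : ∀ k, 1 ≤ k → k ≤ s →
      (Finset.univ.val.map x).esymm k = (Finset.univ.val.map y).esymm k) :
    ∀ k ≤ s, ∑ j, x j ^ k = ∑ j, y j ^ k := by
  have aeval_psum (z : ι → R) (k : ℕ) :
      MvPolynomial.aeval z (MvPolynomial.psum ι R k) = ∑ j, z j ^ k := by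
    simp [MvPolynomial.psum]
  intro k
  induction k using Nat.strong_induction_on with
  | _ k ih =>
    intro hks
    rcases k.eq_zero_or_pos with rfl | hk
    · simp
    rw [← aeval_psum, ← aeval_psum, MvPolynomial.psum_eq_mul_esymm_sub_sum _ _ k hk]
    simp only [map_sub, map_sum, map_mul, map_pow, map_neg, map_one, map_natCast,
      MvPolynomial.aeval_esymm_eq_multiset_esymm, aeval_psum, h k hk hks]
    congr 1
    refine Finset.sum_congr rfl fun a ha => ?_
    simp only [Finset.mem_filter, Finset.HasAntidiagonal.mem_antidiagonal, Set.mem_Ioo] at ha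
    rw [h a.1 (by omega) (by omega), ih a.2 (by omega) (by omega)]

theorem sum_eval_eq_of_sum_pow_eq {ι R : Type*} [Fintype ι] [CommSemiring R] {s : ℕ} {x y : ι → R}
    (h : ∀ k ≤ s, ∑ j, x j ^ k = ∑ j, y j ^ k) {g : R[X]} (hg : g.natDegree ≤ s) :
    ∑ j, g.eval (x j) = ∑ j, g.eval (y j) := by
  simp only [eval_eq_sum_range]
  rw [Finset.sum_comm, Finset.sum_comm (s := Finset.univ)]
  refine Finset.sum_congr rfl fun i hi => ?_
  rw [← Finset.mul_sum, ← Finset.mul_sum, h i ((Finset.mem_range_succ_iff.1 hi).trans hg)]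

theorem exists_derivative_eq {K : Type*} [Field K] [CharZero K] (f : K[X]) :
    ∃ g : K[X], derivative g = f ∧ g.natDegree ≤ f.natDegree + 1 := by
  refine ⟨∑ i ∈ Finset.range (f.natDegree + 1), C (f.coeff i / (i + 1)) * X ^ (i + 1), ?_, ?_⟩
  · conv_rhs => rw [f.as_sum_range_C_mul_X_pow]
    rw [derivative_sum]
    refine Finset.sum_congr rfl fun i _ => ?_
    rw [derivative_C_mul_X_pow, Nat.cast_succ, div_mul_cancel₀ _ i.cast_add_one_ne_zero,
      Nat.add_sub_cancel]
  · refine natDegree_sum_le_of_forall_le _ _ fun i hi => (natDegree_C_mul_X_pow_le _ _).trans ?_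
    exact Nat.succ_le_of_lt (Finset.mem_range.1 hi)

theorem eval_lt_eval_of_derivative_nonneg {g : ℝ[X]} (hg : derivative g ≠ 0) {a b : ℝ}
    (hab : a < b) (h : ∀ τ ∈ Set.Ioo a b, 0 ≤ (derivative g).eval τ) : g.eval a < g.eval b := by
  have hmono : MonotoneOn g.eval (Set.Icc a b) := by
    refine monotoneOn_of_deriv_nonneg (convex_Icc a b) g.continuous.continuousOn
      g.differentiable.differentiableOn fun τ hτ => ?_
    rw [interior_Icc] at hτ
    rw [Polynomial.deriv]
    exact h τ hτ
  have ha : a ∈ Set.Icc a b := Set.left_mem_Icc.2 hab.le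
  have hb : b ∈ Set.Icc a b := Set.right_mem_Icc.2 hab.le
  refine (hmono ha hb hab.le).lt_of_ne fun heq => hg ?_
  have hconst : g = C (g.eval a) := by
    refine eq_of_infinite_eval_eq _ _ ((Set.Icc_infinite hab).mono fun τ hτ => ?_)
    rw [Set.mem_ofPred_eq, eval_C]
    exact le_antisymm ((hmono hτ hb hτ.2).trans heq.ge) (hmono ha hτ hτ.1)
  rw [hconst, derivative_C]

-- An antiderivative of `f` does not decrease when any `y j` is moved to `x j`, and increases
-- strictly when `x j ≠ y j`, although the power sums force its total over both families to agree.
theorem eq_of_sum_pow_eq_of_eval_sign {ι : Type*} [Fintype ι] {k : ℕ} {x y : ι → ℝ}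
    (hpow : ∀ i ≤ k + 1, ∑ j, x j ^ i = ∑ j, y j ^ i) {f : ℝ[X]} (hf : f ≠ 0)
    (hdeg : f.natDegree ≤ k) (hright : ∀ j, ∀ τ ∈ Set.Ioo (y j) (x j), 0 ≤ f.eval τ)
    (hleft : ∀ j, ∀ τ ∈ Set.Ioo (x j) (y j), f.eval τ ≤ 0) : x = y := by
  obtain ⟨g, rfl, hgdeg⟩ := exists_derivative_eq f
  have hlt (j : ι) (hj : x j ≠ y j) : g.eval (y j) < g.eval (x j) := by
    rcases hj.lt_or_gt with hxy | hyx
    · have := eval_lt_eval_of_derivative_nonneg (g := -g) (by simpa using hf) hxy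
        fun τ hτ => by simpa using hleft j τ hτ
      simpa using this
    · exact eval_lt_eval_of_derivative_nonneg hf hyx (hright j)
  have hsum := sum_eval_eq_of_sum_pow_eq hpow (hgdeg.trans (by omega))
  by_contra hne
  obtain ⟨j, hj⟩ := Function.ne_iff.1 hne
  refine (Finset.sum_lt_sum (fun i _ => ?_) ⟨j, Finset.mem_univ j, hlt j hj⟩).ne' hsum
  by_cases hi : x i = y i
  · rw [hi]
  · exact (hlt i hi).le

section Separation

variable {ι : Type*} [LinearOrder ι] {x y : ι → ℝ}

-- With `y i` in the gap, take for `r` the point `x i` clamped to `[a, b]`.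
theorem exists_separating_root (hx : Monotone x) (hy : Monotone y) {a b : ℝ}
    (h : ∃! i, y i ∈ Set.Ioo a b) :
    ∃ r, (∀ j, ∀ τ ∈ Set.Ioo (y j) (x j), 0 ≤ (τ - r) * (τ - b)) ∧
      ∀ j, ∀ τ ∈ Set.Ioo (x j) (y j), 0 ≤ (τ - a) * (τ - r) := by
  obtain ⟨i, hi, huniq⟩ := h
  have hab : a ≤ b := (hi.1.trans hi.2).le
  refine ⟨max a (min (x i) b), fun j τ hτ => ?_, fun j τ hτ => ?_⟩
  · rcases le_total b τ with hb | hb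
    · have hr : max a (min (x i) b) ≤ b := max_le hab (min_le_right _ _)
      exact mul_nonneg (by linarith) (by linarith)
    · have hji : j ≤ i := by
        by_contra! hij
        have hyb : y j < b := hτ.1.trans_le hb
        exact hij.ne' (huniq j ⟨hi.1.trans_le (hy hij.le), hyb⟩)
      have hr : τ ≤ max a (min (x i) b) :=
        le_max_of_le_right (le_min (hτ.2.le.trans (hx hji)) hb)
      exact mul_nonneg_of_nonpos_of_nonpos (by linarith) (by linarith)
  · rcases le_total τ a with ha | ha
    · have hr : a ≤ max a (min (x i) b) := le_max_left _ _
      exact mul_nonneg_of_nonpos_of_nonpos (by linarith) (by linarith)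
    · have hij : i ≤ j := by
        by_contra! hji
        have hay : a < y j := ha.trans_lt hτ.2
        exact hji.ne (huniq j ⟨hay, (hy hji.le).trans_lt hi.2⟩)
      have hr : max a (min (x i) b) ≤ τ :=
        max_le ha (min_le_of_left_le ((hx hij).trans hτ.1.le))
      exact mul_nonneg (by linarith) (by linarith)

theorem exists_separating_polynomial (hx : Monotone x) (hy : Monotone y) {u : ℕ → ℝ}
    (hu : ∀ j, u 0 ≤ y j) {c : ℕ} (hgap : ∀ m < c, ∃! j, y j ∈ Set.Ioo (u m) (u (m + 1))) :
    ∃ T : ℝ[X], T.Monic ∧ T.natDegree = 2 * c ∧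
      (∀ j, ∀ τ ∈ Set.Ioo (y j) (x j), 0 ≤ T.eval τ * (τ - u c)) ∧
      ∀ j, ∀ τ ∈ Set.Ioo (x j) (y j), 0 ≤ T.eval τ := by
  induction c with
  | zero =>
    refine ⟨1, monic_one, natDegree_one, fun j τ hτ => ?_, fun j τ _ => by simp⟩
    simpa using (hu j).trans hτ.1.le
  | succ c ih =>
    obtain ⟨T, hT, hdeg, hTright, hTleft⟩ := ih fun m hm => hgap m (hm.trans c.lt_succ_self)
    obtain ⟨r, hright, hleft⟩ := exists_separating_root hx hy (hgap c c.lt_succ_self)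
    refine ⟨T * ((X - C (u c)) * (X - C r)),
      hT.mul ((monic_X_sub_C _).mul (monic_X_sub_C _)), ?_, fun j τ hτ => ?_, fun j τ hτ => ?_⟩
    · rw [hT.natDegree_mul ((monic_X_sub_C _).mul (monic_X_sub_C _)),
        (monic_X_sub_C _).natDegree_mul (monic_X_sub_C _), natDegree_X_sub_C, natDegree_X_sub_C,
        hdeg]
      ring
    · have := mul_nonneg (hTright j τ hτ) (hright j τ hτ)
      simpa only [eval_mul, eval_sub, eval_X, eval_C, mul_assoc] using this
    · have := mul_nonneg (hTleft j τ hτ) (hleft j τ hτ)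
      simpa only [eval_mul, eval_sub, eval_X, eval_C] using this

variable [Fintype ι] {u : ℕ → ℝ} {c : ℕ}

theorem eq_of_sum_pow_eq_of_mem_Icc (hx : Monotone x) (hy : Monotone y)
    (hu : ∀ j, y j ∈ Set.Icc (u 0) (u c))
    (hgap : ∀ m < c, ∃! j, y j ∈ Set.Ioo (u m) (u (m + 1)))
    (hpow : ∀ k ≤ 2 * c + 2, ∑ j, x j ^ k = ∑ j, y j ^ k) : x = y := by
  obtain ⟨T, hT, hdeg, hright, hleft⟩ :=
    exists_separating_polynomial hx hy (fun j => (hu j).1) hgap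
  have hf : (T * (X - C (u c))).Monic := hT.mul (monic_X_sub_C _)
  refine eq_of_sum_pow_eq_of_eval_sign hpow hf.ne_zero ?_ (fun j τ hτ => ?_) fun j τ hτ => ?_
  · rw [hT.natDegree_mul (monic_X_sub_C _), hdeg, natDegree_X_sub_C]
  · simpa only [eval_mul, eval_sub, eval_X, eval_C] using hright j τ hτ
  · simp only [eval_mul, eval_sub, eval_X, eval_C]
    exact mul_nonpos_of_nonneg_of_nonpos (hleft j τ hτ) (by linarith [hτ.2, (hu j).2])

theorem eq_of_sum_pow_eq_of_mem_Ici (hx : Monotone x) (hy : Monotone y) (hu : ∀ j, u 0 ≤ y j)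
    (hgap : ∀ m < c, ∃! j, y j ∈ Set.Ioo (u m) (u (m + 1))) (hlast : ∃! j, y j ∈ Set.Ioi (u c))
    (hpow : ∀ k ≤ 2 * c + 3, ∑ j, x j ^ k = ∑ j, y j ^ k) : x = y := by
  obtain ⟨M, hxM, hyM⟩ : ∃ M, (∀ j, x j < M) ∧ ∀ j, y j < M :=
    ((Filter.eventually_all.2 fun j => Filter.eventually_gt_atTop (x j)).and
      (Filter.eventually_all.2 fun j => Filter.eventually_gt_atTop (y j))).exists
  obtain ⟨T, hT, hdeg, hright, hleft⟩ := exists_separating_polynomial hx hy hu hgap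
  obtain ⟨r, hrright, hrleft⟩ := exists_separating_root hx hy (a := u c) (b := M)
    (by simpa [hyM] using hlast)
  have hf : (T * (X - C (u c)) * (X - C r)).Monic :=
    (hT.mul (monic_X_sub_C _)).mul (monic_X_sub_C _)
  refine eq_of_sum_pow_eq_of_eval_sign hpow (neg_ne_zero.2 hf.ne_zero) ?_ (fun j τ hτ => ?_)
    fun j τ hτ => ?_
  · rw [natDegree_neg, (hT.mul (monic_X_sub_C _)).natDegree_mul (monic_X_sub_C _),
      hT.natDegree_mul (monic_X_sub_C _), hdeg, natDegree_X_sub_C, natDegree_X_sub_C]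
  · simp only [eval_neg, eval_mul, eval_sub, eval_X, eval_C, Left.nonneg_neg_iff]
    have hτM : τ - M < 0 := by linarith [hτ.2, hxM j]
    exact mul_nonpos_of_nonneg_of_nonpos (hright j τ hτ)
      (nonpos_of_mul_nonneg_left (hrright j τ hτ) hτM)
  · simp only [eval_neg, eval_mul, eval_sub, eval_X, eval_C, Left.neg_nonpos_iff, mul_assoc]
    exact mul_nonneg (hleft j τ hτ) (hrleft j τ hτ)

end Separation

theorem exists_monotone_map_eq {α : Type*} [LinearOrder α] {n : ℕ} {S : Multiset α}
    (hS : S.card = n) : ∃ x : Fin n → α, Monotone x ∧ Finset.univ.val.map x = S := by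
  obtain ⟨l, rfl⟩ := Quot.exists_rep S
  change l.length = n at hS
  subst hS
  refine ⟨l.get ∘ Tuple.sort l.get, Tuple.monotone_sort _, ?_⟩
  rw [← Multiset.map_map, Multiset.map_univ_val_equiv]
  simp

theorem existsUnique_of_countP_map_eq_one {ι α : Type*} [Fintype ι] {f : ι → α} {p : α → Prop}
    [DecidablePred p] (h : (Finset.univ.val.map f).countP p = 1) : ∃! i, p (f i) := by
  rw [Multiset.countP_map] at h
  exact (Fintype.existsUnique_iff_card_one _).2 h

theorem coeff_sub_of_mem_hyperbolic {n k : ℕ} {G : ℝ[X]} (hG : G ∈ hyperbolic n) (hk : k ≤ n) :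
    G.coeff (n - k) = (-1) ^ k * G.roots.esymm k := by
  obtain ⟨hmonic, rfl, hsplits⟩ := hG
  rw [coeff_eq_esymm_roots_of_splits hsplits (Nat.sub_le _ _), hmonic.leadingCoeff, one_mul,
    Nat.sub_sub_self hk]

theorem esymm_roots_eq_of_mem_hyperbolicSlice {n s : ℕ} (hs : s ≤ n) {F H : ℝ[X]}
    (hF : F ∈ hyperbolic n) (hH : H ∈ hyperbolicSlice n s F) {k : ℕ} (hk : 1 ≤ k) (hks : k ≤ s) :
    H.roots.esymm k = F.roots.esymm k := by
  have hcoeff := hH.2 k (Finset.mem_Icc.2 ⟨hk, hks⟩)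
  rw [coeff_sub_of_mem_hyperbolic hH.1 (hks.trans hs),
    coeff_sub_of_mem_hyperbolic hF (hks.trans hs)] at hcoeff
  exact mul_left_cancel₀ (pow_ne_zero _ (neg_ne_zero.2 one_ne_zero)) hcoeff

theorem hyperbolicSlice_eq_singleton_of_sum_pow {n s : ℕ} (hs : s ≤ n) {F : ℝ[X]}
    (hF : F ∈ hyperbolic n)
    (huniq : ∀ x y : Fin n → ℝ, Monotone x → Monotone y → Finset.univ.val.map y = F.roots →
      (∀ k ≤ s, ∑ j, x j ^ k = ∑ j, y j ^ k) → x = y) :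
    hyperbolicSlice n s F = {F} := by
  refine Set.eq_singleton_iff_unique_mem.2 ⟨⟨hF, fun _ _ => rfl⟩, fun H hH => ?_⟩
  obtain ⟨x, hx, hxH⟩ := exists_monotone_map_eq (card_roots_of_mem_hyperbolic hH.1)
  obtain ⟨y, hy, hyF⟩ := exists_monotone_map_eq (card_roots_of_mem_hyperbolic hF)
  have hxy : x = y := huniq x y hx hy hyF <| sum_pow_eq_of_esymm_eq fun k hk hks => by
    rw [hxH, hyF, esymm_roots_eq_of_mem_hyperbolicSlice hs hF hH hk hks]
  rw [hH.1.2.2.eq_prod_roots_of_monic hH.1.1, hF.2.2.eq_prod_roots_of_monic hF.1, ← hxH, ← hyF,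
    hxy]

section RigidSlices

variable {n c : ℕ} {F : ℝ[X]} {u : ℕ → ℝ}

theorem hyperbolicSlice_eq_singleton_of_roots_mem_Icc (hc : 2 * c + 2 ≤ n) (hF : F ∈ hyperbolic n)
    (hu : ∀ a ∈ F.roots, a ∈ Set.Icc (u 0) (u c))
    (hgap : ∀ m < c, F.roots.countP (· ∈ Set.Ioo (u m) (u (m + 1))) = 1) :
    hyperbolicSlice n (2 * c + 2) F = {F} := by
  refine hyperbolicSlice_eq_singleton_of_sum_pow hc hF fun x y hx hy hyF hpow => ?_
  rw [← hyF] at hu hgap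
  exact eq_of_sum_pow_eq_of_mem_Icc hx hy
    (fun j => hu _ (Multiset.mem_map_of_mem y (Finset.mem_univ j)))
    (fun m hm => existsUnique_of_countP_map_eq_one (hgap m hm)) hpow

theorem hyperbolicSlice_eq_singleton_of_roots_mem_Ici (hc : 2 * c + 3 ≤ n) (hF : F ∈ hyperbolic n)
    (hu : ∀ a ∈ F.roots, a ∈ Set.Ici (u 0))
    (hgap : ∀ m < c, F.roots.countP (· ∈ Set.Ioo (u m) (u (m + 1))) = 1)
    (hlast : F.roots.countP (· ∈ Set.Ioi (u c)) = 1) :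
    hyperbolicSlice n (2 * c + 3) F = {F} := by
  refine hyperbolicSlice_eq_singleton_of_sum_pow hc hF fun x y hx hy hyF hpow => ?_
  rw [← hyF] at hu hgap hlast
  exact eq_of_sum_pow_eq_of_mem_Ici hx hy
    (fun j => hu _ (Multiset.mem_map_of_mem y (Finset.mem_univ j)))
    (fun m hm => existsUnique_of_countP_map_eq_one (hgap m hm))
    (existsUnique_of_countP_map_eq_one hlast) hpow

end RigidSlices

section PrescribedRoots

variable {ι : Type*} [Fintype ι] {a : ι → ℝ} {m : ι → ℕ}

/-- The monic polynomial in which each point `a i` is a root of multiplicity `m i` (for injective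
`a`); it realises a partition as the root partition of a hyperbolic polynomial. -/
noncomputable def polyWithRoots (a : ι → ℝ) (m : ι → ℕ) : ℝ[X] :=
  ∏ i, (X - C (a i)) ^ m i

theorem polyWithRoots_mem_hyperbolic {n : ℕ} (hm : ∑ i, m i = n) :
    polyWithRoots a m ∈ hyperbolic n := by
  have hmonic (i : ι) : ((X - C (a i)) ^ m i).Monic := (monic_X_sub_C _).pow _
  refine ⟨monic_prod_of_monic _ _ fun i _ => hmonic i, ?_,
    Splits.prod fun i _ => (Splits.X_sub_C _).pow _⟩
  simp [polyWithRoots, natDegree_prod_of_monic _ _ fun i _ => hmonic i, hm]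

theorem roots_polyWithRoots : (polyWithRoots a m).roots = ∑ i, m i • {a i} := by
  have h0 : polyWithRoots a m ≠ 0 :=
    (monic_prod_of_monic _ _ fun i _ => (monic_X_sub_C (a i)).pow (m i)).ne_zero
  rw [polyWithRoots, roots_prod _ _ h0]
  simp only [roots_pow, roots_X_sub_C]
  rfl

theorem mem_roots_polyWithRoots {b : ℝ} (hb : b ∈ (polyWithRoots a m).roots) :
    b ∈ Set.range a := by
  rw [roots_polyWithRoots] at hb
  obtain ⟨i, -, hi⟩ := Multiset.mem_sum.1 hb
  exact ⟨i, (Multiset.mem_singleton.1 (Multiset.mem_of_mem_nsmul hi)).symm⟩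

theorem countP_roots_polyWithRoots (p : ℝ → Prop) [DecidablePred p] :
    (polyWithRoots a m).roots.countP p = ∑ i with p (a i), m i := by
  rw [roots_polyWithRoots, ← Multiset.coe_countPAddMonoidHom, map_sum, Finset.sum_filter]
  refine Finset.sum_congr rfl fun i _ => ?_
  rw [map_nsmul, Multiset.coe_countPAddMonoidHom, smul_eq_mul, ← Multiset.cons_zero]
  split_ifs with hp
  · rw [Multiset.countP_cons_of_pos _ hp, Multiset.countP_zero, zero_add, mul_one]
  · rw [Multiset.countP_cons_of_neg _ hp, Multiset.countP_zero, mul_zero]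

theorem rootPartition_polyWithRoots_parts {n : ℕ} (ha : a.Injective) (hm : ∀ i, 0 < m i)
    (hF : polyWithRoots a m ∈ hyperbolic n) :
    (rootPartition (polyWithRoots a m) hF).parts = Finset.univ.val.map m := by
  classical
  have hcount (i : ι) : (polyWithRoots a m).roots.count (a i) = m i := by
    simp [Multiset.count, countP_roots_polyWithRoots, ha.eq_iff, Finset.sum_filter]
  have hdedup : (polyWithRoots a m).roots.dedup = Finset.univ.val.map a := by
    refine (Multiset.Nodup.ext (Multiset.nodup_dedup _) (Finset.univ.nodup.map ha)).2 fun b => ?_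
    rw [Multiset.mem_dedup, Multiset.mem_map]
    constructor
    · intro hb
      obtain ⟨i, rfl⟩ := mem_roots_polyWithRoots hb
      exact ⟨i, Finset.mem_univ i, rfl⟩
    · rintro ⟨i, -, rfl⟩
      exact Multiset.count_pos.1 ((hm i).trans_eq (hcount i).symm)
  change (polyWithRoots a m).roots.dedup.map (fun b => (polyWithRoots a m).roots.count b) = _
  rw [hdedup, Multiset.map_map]
  exact Multiset.map_congr rfl fun i _ => hcount i

end PrescribedRoots

section Alternating

variable {c o : ℕ}

/-- The points `0, 2, …, 2 * c` followed by `1, 3, …, 2 * o - 1`. With arbitrary multiplicities at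
the former and multiplicity one at the latter they are the roots of the polynomials whose slices
are shown to be singletons. -/
def alternatingPoints (c o : ℕ) : Fin (c + 1) ⊕ Fin o → ℝ :=
  Sum.elim (fun k => 2 * k) fun k => 2 * k + 1

theorem alternatingPoints_injective : (alternatingPoints c o).Injective := by
  rintro (j | j) (k | k) h <;> simp only [alternatingPoints, Sum.elim_inl, Sum.elim_inr] at h <;>
    norm_cast at h
  · exact congrArg Sum.inl (Fin.ext (by omega))
  · omega
  · omega
  · exact congrArg Sum.inr (Fin.ext (by omega))

theorem alternatingPoints_nonneg (i : Fin (c + 1) ⊕ Fin o) : 0 ≤ alternatingPoints c o i := by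
  rcases i with k | k <;> simp only [alternatingPoints, Sum.elim_inl, Sum.elim_inr] <;> positivity

theorem alternatingPoints_le (ho : o ≤ c) (i : Fin (c + 1) ⊕ Fin o) :
    alternatingPoints c o i ≤ 2 * c := by
  rcases i with k | k <;> simp only [alternatingPoints, Sum.elim_inl, Sum.elim_inr] <;>
    norm_cast <;> omega

theorem filter_alternatingPoints_mem_Ioo {m : ℕ} (hm : m < o) :
    ({i | alternatingPoints c o i ∈ Set.Ioo ((2 * m : ℕ) : ℝ) ((2 * (m + 1) : ℕ) : ℝ)} : Finset _) =
      {Sum.inr ⟨m, hm⟩} := by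
  ext (k | k) <;> simp only [alternatingPoints, Sum.elim_inl, Sum.elim_inr, Finset.mem_filter,
    Finset.mem_univ, true_and, Set.mem_Ioo, Finset.mem_singleton, reduceCtorEq, Sum.inr.injEq,
    Fin.ext_iff, iff_false] <;> norm_cast <;> omega

theorem filter_alternatingPoints_mem_Ioi :
    ({i | alternatingPoints c (c + 1) i ∈ Set.Ioi ((2 * c : ℕ) : ℝ)} : Finset _) =
      {Sum.inr (Fin.last c)} := by
  ext (k | k) <;> simp only [alternatingPoints, Sum.elim_inl, Sum.elim_inr, Finset.mem_filter,
    Finset.mem_univ, true_and, Set.mem_Ioi, Finset.mem_singleton, reduceCtorEq, Sum.inr.injEq,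
    Fin.ext_iff, Fin.val_last, iff_false] <;> norm_cast <;> omega

theorem hyperbolicSlice_alternatingPoints_eq_singleton {n : ℕ} (ho : o = c ∨ o = c + 1)
    (hn : c + 1 + o + 1 ≤ n) {m : Fin (c + 1) ⊕ Fin o → ℕ} (hm : ∀ k, m (Sum.inr k) = 1)
    (hF : polyWithRoots (alternatingPoints c o) m ∈ hyperbolic n) :
    hyperbolicSlice n (c + 1 + o + 1) (polyWithRoots (alternatingPoints c o) m) =
      {polyWithRoots (alternatingPoints c o) m} := by
  have hgap (k : ℕ) (hk : k < o) : (polyWithRoots (alternatingPoints c o) m).roots.countP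
      (· ∈ Set.Ioo ((2 * k : ℕ) : ℝ) ((2 * (k + 1) : ℕ) : ℝ)) = 1 := by
    rw [countP_roots_polyWithRoots, filter_alternatingPoints_mem_Ioo hk, Finset.sum_singleton, hm]
  rcases ho with rfl | rfl
  · rw [show o + 1 + o + 1 = 2 * o + 2 by ring] at hn ⊢
    refine hyperbolicSlice_eq_singleton_of_roots_mem_Icc (u := fun k => ((2 * k : ℕ) : ℝ)) hn hF
      (fun b hb => ?_) hgap
    obtain ⟨i, rfl⟩ := mem_roots_polyWithRoots hb
    simpa using ⟨alternatingPoints_nonneg i, alternatingPoints_le le_rfl i⟩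
  · rw [show c + 1 + (c + 1) + 1 = 2 * c + 3 by ring] at hn ⊢
    refine hyperbolicSlice_eq_singleton_of_roots_mem_Ici (u := fun k => ((2 * k : ℕ) : ℝ)) hn hF
      (fun b hb => ?_) (fun k hk => hgap k (hk.trans c.lt_succ_self)) ?_
    · obtain ⟨i, rfl⟩ := mem_roots_polyWithRoots hb
      simpa using alternatingPoints_nonneg i
    · rw [countP_roots_polyWithRoots, filter_alternatingPoints_mem_Ioi, Finset.sum_singleton, hm]

end Alternating

section BigParts

/-- The elements of a multiset that are at least `2`. A partition with few big parts is realised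
by a polynomial with a singleton slice; their number also sorts the partitions of the covering. -/
def bigParts (A : Multiset ℕ) : Multiset ℕ := A.filter (2 ≤ ·)

theorem bigParts_add_replicate_one {A : Multiset ℕ} (hA : ∀ a ∈ A, 0 < a) :
    bigParts A + Multiset.replicate (A.card - (bigParts A).card) 1 = A := by
  have hsplit := Multiset.filter_add_not (2 ≤ ·) A
  have hones : A.filter (¬ 2 ≤ ·) =
      Multiset.replicate (A.filter (¬ 2 ≤ ·)).card 1 := by
    refine Multiset.eq_replicate_card.2 fun a ha => ?_
    have := hA a (Multiset.mem_of_mem_filter ha)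
    have := Multiset.of_mem_filter ha
    omega
  have hcard : A.card - (bigParts A).card = (A.filter (¬ 2 ≤ ·)).card := by
    rw [← congrArg Multiset.card hsplit, Multiset.card_add, bigParts, Nat.add_sub_cancel_left]
  rw [hcard, ← hones]
  exact hsplit

theorem exists_eq_map_add_replicate_one {A : Multiset ℕ} (hA : ∀ a ∈ A, 0 < a) {c o : ℕ}
    (hcard : A.card = c + o) (hbig : (bigParts A).card ≤ c) :
    ∃ b : Fin c → ℕ, A = Finset.univ.val.map b + Multiset.replicate o 1 := by
  obtain ⟨b, -, hb⟩ := exists_monotone_map_eq (n := c)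
    (S := bigParts A + Multiset.replicate (c - (bigParts A).card) 1)
    (by rw [Multiset.card_add, Multiset.card_replicate]; omega)
  refine ⟨b, ?_⟩
  rw [hb, add_assoc, ← Multiset.replicate_add,
    show c - (bigParts A).card + o = A.card - (bigParts A).card by omega,
    bigParts_add_replicate_one hA]

theorem exists_hyperbolicSlice_eq_singleton {n d : ℕ} (hd : 0 < d) (hdn : d + 1 ≤ n)
    {p : n.Partition} (hp : p.parts.card = d) (hbig : (bigParts p.parts).card ≤ (d + 1) / 2) :
    ∃ (F : ℝ[X]) (hF : F ∈ hyperbolic n),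
      rootPartition F hF = p ∧ hyperbolicSlice n (d + 1) F = {F} := by
  obtain ⟨c, o, rfl, ho⟩ : ∃ c o, d = c + 1 + o ∧ (o = c ∨ o = c + 1) :=
    ⟨(d - 1) / 2, d / 2, by omega, by omega⟩
  obtain ⟨b, hb⟩ := exists_eq_map_add_replicate_one (fun _ ha => p.parts_pos ha) hp
    (hbig.trans (by omega))
  set m : Fin (c + 1) ⊕ Fin o → ℕ := Sum.elim b 1
  have hparts : p.parts = Finset.univ.val.map m := by
    rw [hb, ← Finset.univ_disjSum_univ]
    simp [Finset.disjSum, Multiset.map_disjSum, m]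
  have hm (i) : 0 < m i :=
    p.parts_pos (hparts ▸ Multiset.mem_map_of_mem m (Finset.mem_univ i))
  have hF : polyWithRoots (alternatingPoints c o) m ∈ hyperbolic n :=
    polyWithRoots_mem_hyperbolic (by rw [← p.parts_sum, hparts]; rfl)
  refine ⟨_, hF, Nat.Partition.ext ?_,
    hyperbolicSlice_alternatingPoints_eq_singleton ho hdn (fun _ => rfl) hF⟩
  rw [rootPartition_polyWithRoots_parts alternatingPoints_injective hm, hparts]

theorem IsVandermondeCovering.exists_mergeLE {n d : ℕ} (hd : 0 < d) (hdn : d + 1 ≤ n)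
    {P : Finset n.Partition} (hP : IsVandermondeCovering n (d + 1) P) {p : n.Partition}
    (hp : p.parts.card = d) (hbig : (bigParts p.parts).card ≤ (d + 1) / 2) :
    ∃ q ∈ P, MergeLE p q := by
  obtain ⟨F, hF, rfl, hslice⟩ := exists_hyperbolicSlice_eq_singleton hd hdn hp hbig
  obtain ⟨q, hq, G, hG, hle⟩ := hP.2 F hF
  obtain rfl : G = F := by rwa [hslice] at hG
  exact ⟨q, hq, hle⟩

end BigParts

section Merging

theorem card_le_card_join {α : Type*} {S : Multiset (Multiset α)} (h0 : ∀ b ∈ S, b ≠ 0) :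
    S.card ≤ S.join.card := by
  have h1 : ∀ k ∈ S.map Multiset.card, 1 ≤ k := by
    simpa only [Multiset.mem_map, forall_exists_index, and_imp, forall_apply_eq_imp_iff₂,
      Nat.one_le_iff_ne_zero, ne_eq, Multiset.card_eq_zero] using h0
  simpa [Multiset.card_join] using Multiset.card_nsmul_le_sum h1

theorem map_sum_eq_join_of_card_join_eq {M : Type*} [AddCommMonoid M] {S : Multiset (Multiset M)}
    (h0 : ∀ b ∈ S, b ≠ 0) (h : S.join.card = S.card) : S.map Multiset.sum = S.join := by
  induction S using Multiset.induction_on with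
  | empty => simp
  | cons b S ih =>
    rw [Multiset.forall_mem_cons] at h0
    have hb := Multiset.card_pos.2 h0.1
    have hS := card_le_card_join h0.2
    rw [Multiset.join_cons, Multiset.card_add, Multiset.card_cons] at h
    obtain ⟨a, rfl⟩ := Multiset.card_eq_one.1 (show b.card = 1 by omega)
    rw [Multiset.map_cons, ih h0.2 (by omega), Multiset.join_cons, Multiset.sum_singleton,
      Multiset.singleton_add]

theorem exists_join_eq_cons_cons_of_card_join_eq_succ {M : Type*} [AddCommMonoid M]
    {S : Multiset (Multiset M)} (h0 : ∀ b ∈ S, b ≠ 0) (h : S.join.card = S.card + 1) :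
    ∃ a b r, S.join = a ::ₘ b ::ₘ r ∧ S.map Multiset.sum = (a + b) ::ₘ r := by
  induction S using Multiset.induction_on with
  | empty => simp at h
  | cons b S ih =>
    rw [Multiset.forall_mem_cons] at h0
    have hb := Multiset.card_pos.2 h0.1
    have hS := card_le_card_join h0.2
    rw [Multiset.join_cons, Multiset.card_add, Multiset.card_cons] at h
    obtain hb1 | hb2 : b.card = 1 ∨ b.card = 2 := by omega
    · obtain ⟨c, rfl⟩ := Multiset.card_eq_one.1 hb1
      obtain ⟨x, y, r, hjoin, hsum⟩ := ih h0.2 (by omega)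
      refine ⟨x, y, c ::ₘ r, ?_, ?_⟩
      · rw [Multiset.join_cons, hjoin, Multiset.singleton_add, Multiset.cons_swap c x,
          Multiset.cons_swap c y]
      · rw [Multiset.map_cons, hsum, Multiset.sum_singleton, Multiset.cons_swap]
    · obtain ⟨x, y, rfl⟩ := Multiset.card_eq_two.1 hb2
      refine ⟨x, y, S.join, by simp, ?_⟩
      rw [Multiset.map_cons, map_sum_eq_join_of_card_join_eq h0.2 (by omega), Multiset.sum_pair]

theorem MergeLE.exists_parts_eq_cons {n : ℕ} {p q : n.Partition} (h : MergeLE p q)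
    (hcard : q.parts.card = p.parts.card + 1) :
    ∃ a b r, q.parts = a ::ₘ b ::ₘ r ∧ p.parts = (a + b) ::ₘ r := by
  obtain ⟨blocks, hjoin, hsum⟩ := h
  rw [← hjoin, ← hsum]
  refine exists_join_eq_cons_cons_of_card_join_eq_succ ?_ ?_
  · rintro _ hb rfl
    have hmem : (0 : Multiset ℕ).sum ∈ p.parts := hsum ▸ Multiset.mem_map_of_mem _ hb
    exact (p.parts_pos hmem).ne' Multiset.sum_zero
  · rw [hjoin, hcard, ← hsum, Multiset.card_map]

/-- The multisets with `i` elements exceeding one that can arise from the multiset `A` of positive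
integers by adding two of its elements. The cases say that the two elements are both big, that one
of them is, or that neither is. -/
def mergeCandidates (A : Multiset ℕ) (i : ℕ) : Finset (Multiset ℕ) :=
  if (bigParts A).card = i + 1 then
    (((bigParts A).powersetCard 2).map fun u => u.sum ::ₘ (A - u)).toFinset
  else if (bigParts A).card = i then
    ((bigParts A).map fun a => (a + 1) ::ₘ (A - {a, 1})).toFinset
  else if (bigParts A).card + 1 = i then {2 ::ₘ (A - {1, 1})}
  else ∅

/-- The bound on the number of multisets with `i` elements exceeding one that arise by adding two
elements of a multiset with `j` elements exceeding one. -/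
def mergeWeight (j i : ℕ) : ℕ :=
  if j = i + 1 then (i + 1).choose 2 else if j = i then i else if j + 1 = i then 1 else 0

theorem card_mergeCandidates_le (A : Multiset ℕ) (i : ℕ) :
    (mergeCandidates A i).card ≤ mergeWeight (bigParts A).card i := by
  unfold mergeCandidates mergeWeight
  split_ifs with hpair hone
  · refine (Multiset.toFinset_card_le _).trans_eq ?_
    rw [Multiset.card_map, Multiset.card_powersetCard, hpair]
  · refine (Multiset.toFinset_card_le _).trans_eq ?_
    rw [Multiset.card_map, hone]
  · exact (Finset.card_singleton _).le
  · exact Finset.card_empty.le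

theorem cons_cons_sub_pair {α : Type*} [DecidableEq α] (a b : α) (r : Multiset α) :
    a ::ₘ b ::ₘ r - {a, b} = r := by
  rw [← Multiset.singleton_add, ← Multiset.singleton_add, ← add_assoc, Multiset.singleton_add,
    ← Multiset.insert_eq_cons, add_tsub_cancel_left]

theorem mem_mergeCandidates {a b : ℕ} {r : Multiset ℕ} (ha : 0 < a) (hb : 0 < b) :
    (a + b) ::ₘ r ∈ mergeCandidates (a ::ₘ b ::ₘ r) (bigParts ((a + b) ::ₘ r)).card := by
  wlog hba : b ≤ a generalizing a b
  · rw [add_comm, Multiset.cons_swap]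
    exact this hb ha (le_of_not_ge hba)
  have hsum : (bigParts ((a + b) ::ₘ r)).card = (bigParts r).card + 1 := by
    simp [bigParts, show 2 ≤ a + b by omega]
  obtain hb2 | rfl : 2 ≤ b ∨ b = 1 := by omega
  · have hbig : bigParts (a ::ₘ b ::ₘ r) = a ::ₘ b ::ₘ bigParts r := by
      simp [bigParts, hb2, hb2.trans hba]
    rw [mergeCandidates, if_pos (by simp [hbig, hsum]), hbig, Multiset.mem_toFinset,
      Multiset.mem_map]
    refine ⟨{a, b}, Multiset.mem_powersetCard.2 ⟨?_, Multiset.card_pair a b⟩, ?_⟩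
    · exact Multiset.cons_le_cons _ (Multiset.cons_le_cons _ (Multiset.zero_le _))
    · rw [cons_cons_sub_pair, Multiset.sum_pair]
  obtain ha2 | rfl : 2 ≤ a ∨ a = 1 := by omega
  · have hbig : bigParts (a ::ₘ 1 ::ₘ r) = a ::ₘ bigParts r := by simp [bigParts, ha2]
    rw [mergeCandidates, if_neg (by simp [hbig, hsum]), if_pos (by simp [hbig, hsum]), hbig,
      Multiset.mem_toFinset, Multiset.mem_map]
    exact ⟨a, Multiset.mem_cons_self _ _, by rw [cons_cons_sub_pair]⟩
  · have hbig : bigParts (1 ::ₘ 1 ::ₘ r) = bigParts r := by simp [bigParts]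
    rw [mergeCandidates, if_neg (by simp [hbig, hsum]; omega), if_neg (by simp [hbig, hsum]),
      if_pos (by rw [hbig, hsum]), cons_cons_sub_pair]
    exact Finset.mem_singleton_self _

open Classical in
theorem card_filter_mergeLE_le {n d i : ℕ} {q : n.Partition} (hq : q ∈ partitionsInto n (d + 1)) :
    ((partitionsInto n d).filter fun p => (bigParts p.parts).card = i ∧ MergeLE p q).card ≤
      mergeWeight (bigParts q.parts).card i := by
  refine le_trans (Finset.card_le_card_of_injOn Nat.Partition.parts (fun p hp => ?_)
    fun p _ p' _ h => Nat.Partition.ext h) (card_mergeCandidates_le q.parts i)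
  obtain ⟨hpd, rfl, hle⟩ := Finset.mem_filter.1 hp
  have hcard : q.parts.card = p.parts.card + 1 := by
    rw [(Finset.mem_filter.1 hq).2, (Finset.mem_filter.1 hpd).2]
  obtain ⟨a, b, r, hqr, hpr⟩ := hle.exists_parts_eq_cons hcard
  rw [hqr, hpr]
  exact mem_mergeCandidates (q.parts_pos (by simp [hqr])) (q.parts_pos (by simp [hqr]))

end Merging

section Counting

/-- The partition obtained by adding one to every part of `μ` and then adjoining ones so that there
are `d` parts, for `μ` with at most `d` parts. It identifies `𝒫(m, i)` with the partitions of
`m + d` into `d` parts, `i` of which exceed one. -/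
def succPad {m d : ℕ} (μ : m.Partition) (hμ : μ.parts.card ≤ d) : (m + d).Partition where
  parts := μ.parts.map (· + 1) + Multiset.replicate (d - μ.parts.card) 1
  parts_pos {a} ha := by
    rcases Multiset.mem_add.1 ha with ha | ha
    · obtain ⟨b, -, rfl⟩ := Multiset.mem_map.1 ha
      exact b.succ_pos
    · rw [Multiset.eq_of_mem_replicate ha]
      exact one_pos
  parts_sum := by
    rw [Multiset.sum_add, Multiset.sum_map_add, Multiset.map_id', μ.parts_sum,
      Multiset.map_const', Multiset.sum_replicate, Multiset.sum_replicate, smul_eq_mul,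
      smul_eq_mul]
    omega


theorem card_parts_succPad {m d : ℕ} {μ : m.Partition} (hμ : μ.parts.card ≤ d) :
    (succPad μ hμ).parts.card = d := by
  rw [succPad, Multiset.card_add, Multiset.card_map, Multiset.card_replicate,
    Nat.add_sub_cancel' hμ]

theorem bigParts_succPad {m d : ℕ} {μ : m.Partition} (hμ : μ.parts.card ≤ d) :
    bigParts (succPad μ hμ).parts = μ.parts.map (· + 1) := by
  rw [bigParts, succPad, Multiset.filter_add, Multiset.filter_eq_self.2, Multiset.filter_eq_nil.2,
    add_zero]
  · intro a ha
    rw [Multiset.eq_of_mem_replicate ha]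
    decide
  · intro a ha
    obtain ⟨b, hb, rfl⟩ := Multiset.mem_map.1 ha
    exact Nat.succ_le_succ (μ.parts_pos hb)

theorem card_partitionsInto_le_card_filter_bigParts {m d i : ℕ} (hi : i ≤ d) :
    (partitionsInto m i).card ≤
      ((partitionsInto (m + d) d).filter fun p => (bigParts p.parts).card = i).card := by
  have hcard {μ : m.Partition} (hμ : μ ∈ partitionsInto m i) : μ.parts.card = i :=
    (Finset.mem_filter.1 hμ).2
  rw [← Finset.card_attach]
  refine Finset.card_le_card_of_injOn (fun μ => succPad μ.1 ((hcard μ.2).trans_le hi))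
    (fun μ _ => ?_) fun μ _ ν _ h => ?_
  · refine Finset.mem_filter.2 ⟨Finset.mem_filter.2 ⟨Finset.mem_univ _, card_parts_succPad _⟩, ?_⟩
    rw [bigParts_succPad, Multiset.card_map, hcard μ.2]
  · have hbig := congrArg (fun p => bigParts p.parts) h
    simp only [bigParts_succPad] at hbig
    exact Subtype.ext (Nat.Partition.ext (Multiset.map_injective (add_left_injective 1) hbig))

theorem IsVandermondeCovering.card_partitionsInto_le {m d i : ℕ} (hm : 0 < m) (hd : 0 < d)
    {P : Finset (m + d).Partition} (hP : IsVandermondeCovering (m + d) (d + 1) P)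
    (hi : i ≤ (d + 1) / 2) :
    (partitionsInto m i).card ≤ ∑ q ∈ P, mergeWeight (bigParts q.parts).card i := by
  classical
  let below (q : (m + d).Partition) :=
    (partitionsInto (m + d) d).filter fun p => (bigParts p.parts).card = i ∧ MergeLE p q
  have hcover : ((partitionsInto (m + d) d).filter fun p => (bigParts p.parts).card = i) ⊆
      P.biUnion below := by
    intro p hp
    obtain ⟨hpd, hbig⟩ := Finset.mem_filter.1 hp
    obtain ⟨q, hq, hle⟩ := hP.exists_mergeLE hd (by omega) (Finset.mem_filter.1 hpd).2
      (hbig.trans_le hi)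
    exact Finset.mem_biUnion.2 ⟨q, hq, Finset.mem_filter.2 ⟨hpd, hbig, hle⟩⟩
  calc (partitionsInto m i).card
      ≤ _ := card_partitionsInto_le_card_filter_bigParts (by omega)
    _ ≤ (P.biUnion below).card := Finset.card_le_card hcover
    _ ≤ ∑ q ∈ P, (below q).card := Finset.card_biUnion_le
    _ ≤ ∑ q ∈ P, mergeWeight (bigParts q.parts).card i :=
      Finset.sum_le_sum fun _ hq => card_filter_mergeLE_le (hP.1 hq)

theorem sum_mergeWeight {α : Type*} (P : Finset α) (f : α → ℕ) (i : ℕ) :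
    ∑ q ∈ P, mergeWeight (f q) (i + 1) =
      (i + 2).choose 2 * (P.filter fun q => f q = i + 2).card +
        (i + 1) * (P.filter fun q => f q = i + 1).card + (P.filter fun q => f q = i).card := by
  simp only [Finset.card_filter, Finset.mul_sum, ← Finset.sum_add_distrib]
  refine Finset.sum_congr rfl fun q _ => ?_
  simp only [mergeWeight, add_assoc, Nat.reduceAdd]
  split_ifs <;> omega

theorem card_partitionsInto_one_pos {m : ℕ} (hm : 0 < m) : 0 < (partitionsInto m 1).card :=
  Finset.card_pos.2 ⟨Nat.Partition.indiscrete m, Finset.mem_filter.2 ⟨Finset.mem_univ _, by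
    rw [Nat.Partition.indiscrete_parts hm.ne', Multiset.card_singleton]⟩⟩

end Counting

section Recursion

theorem B_add_two_le {n s i : ℕ} {y : ℤ}
    (h : ((partitionsInto (n - s + 1) (i + 2)).card : ℤ) - (i + 2) * B n s (i + 1) - B n s i ≤
      (i + 3).choose 2 * y) :
    B n s (i + 2) ≤ y := by
  have hchoose : ((i + 2 : ℕ) : ℚ) ^ 2 + ((i + 2 : ℕ) : ℚ) = 2 * ((i + 3).choose 2 : ℕ) := by
    rw [Nat.cast_choose_two]
    push_cast
    ring
  have hℚ : ((partitionsInto (n - s + 1) (i + 2)).card : ℚ) - (i + 2) * B n s (i + 1) - B n s i ≤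
      ((i + 3).choose 2 : ℕ) * y := by
    exact_mod_cast h
  rw [B, Int.ceil_le, div_le_iff₀ (by positivity), hchoose]
  push_cast
  linear_combination 2 * hℚ

-- Abel summation: the coefficients `1 ≤ i + 2 ≤ (i + 3).choose 2` increase, so the counting
-- inequality can be combined with the three preceding bounds on partial sums.
theorem sum_B_le_of_sum_B_le {n s i : ℕ} {x : ℕ → ℕ}
    (hN : (partitionsInto (n - s + 1) (i + 2)).card ≤
      (i + 3).choose 2 * x (i + 3) + (i + 2) * x (i + 2) + x (i + 1))
    (h₀ : ∑ j ∈ Finset.range i, B n s j ≤ ∑ j ∈ Finset.range (i + 1), (x j : ℤ))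
    (h₁ : ∑ j ∈ Finset.range (i + 1), B n s j ≤ ∑ j ∈ Finset.range (i + 2), (x j : ℤ))
    (h₂ : ∑ j ∈ Finset.range (i + 2), B n s j ≤ ∑ j ∈ Finset.range (i + 3), (x j : ℤ)) :
    ∑ j ∈ Finset.range (i + 3), B n s j ≤ ∑ j ∈ Finset.range (i + 4), (x j : ℤ) := by
  zify at hN
  have hchoose : (i + 2 : ℤ) ≤ (i + 3).choose 2 := by
    have := Nat.choose_succ_succ (i + 2) 1
    rw [Nat.choose_one_right] at this
    exact_mod_cast this ▸ Nat.le_add_right _ _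
  have h₂' := mul_nonneg (sub_nonneg.2 hchoose) (sub_nonneg.2 h₂)
  have h₁' := mul_nonneg (show (0 : ℤ) ≤ i + 1 by positivity) (sub_nonneg.2 h₁)
  rw [Finset.sum_range_succ _ (i + 2), ← le_sub_iff_add_le']
  refine B_add_two_le ?_
  simp only [Finset.sum_range_succ] at h₀ h₁' h₂' ⊢
  linear_combination hN + h₀ + h₁' + h₂'

theorem sum_B_le {n s K : ℕ} {x : ℕ → ℕ} (hpos : 0 < (partitionsInto (n - s + 1) 1).card)
    (hN : ∀ i < K, (partitionsInto (n - s + 1) (i + 1)).card ≤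
      (i + 2).choose 2 * x (i + 2) + (i + 1) * x (i + 1) + x i) :
    ∀ k ≤ K + 1, ∑ i ∈ Finset.range k, B n s i ≤ ∑ j ∈ Finset.range (k + 1), (x j : ℤ) := by
  intro k
  induction k using Nat.strong_induction_on with
  | _ k ih =>
    intro hk
    match k with
    | 0 => simp
    | 1 => simpa [B] using Finset.sum_nonneg fun j _ => Int.natCast_nonneg (x j)
    | 2 =>
      have h := hpos.trans_le (hN 0 (by omega))
      have hsum : 1 ≤ ∑ j ∈ Finset.range 3, x j := by
        simp only [Finset.sum_range_succ, Finset.sum_range_zero]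
        simp only [zero_add, Nat.choose_self] at h
        omega
      simpa [Finset.sum_range_succ _ 1, B] using Int.ofNat_le.2 hsum
    | i + 3 =>
      exact sum_B_le_of_sum_B_le (hN (i + 1) (by omega)) (ih i (by omega) (by omega))
        (ih (i + 1) (by omega) (by omega)) (ih (i + 2) (by omega) (by omega))

end Recursion

end VandermondeCovering

theorem theorem4 (n s : ℕ) (hs : s ≤ n) (P : Finset n.Partition)
    (hP : VandermondeCovering.IsVandermondeCovering n s P) :
    ∑ i ∈ Finset.range (s / 2 + 1), VandermondeCovering.B n s i ≤ (P.card : ℤ) := by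
  open VandermondeCovering in
  obtain hs2 | hs2 := lt_or_ge s 2
  · rw [Nat.div_eq_of_lt hs2, zero_add, Finset.sum_range_one, B]
    positivity
  obtain ⟨d, rfl⟩ := Nat.exists_eq_add_of_le' (Nat.one_le_of_lt hs2)
  obtain ⟨m, rfl⟩ := Nat.exists_eq_add_of_le' (Nat.le_of_succ_le hs)
  have hm : m + d - (d + 1) + 1 = m := by omega
  let x (j : ℕ) : ℕ := (P.filter fun q => (bigParts q.parts).card = j).card
  have hcount (i : ℕ) (hi : i < (d + 1) / 2) : (partitionsInto m (i + 1)).card ≤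
      (i + 2).choose 2 * x (i + 2) + (i + 1) * x (i + 1) + x i :=
    (hP.card_partitionsInto_le (by omega) (by omega) hi).trans_eq (sum_mergeWeight P _ i)
  have hx : ∑ j ∈ Finset.range ((d + 1) / 2 + 2), x j ≤ P.card :=
    (Finset.sum_card_fiberwise_eq_card_filter P _ _).trans_le (Finset.card_filter_le _ _)
  calc ∑ i ∈ Finset.range ((d + 1) / 2 + 1), B (m + d) (d + 1) i
      ≤ ∑ j ∈ Finset.range ((d + 1) / 2 + 2), (x j : ℤ) :=
        sum_B_le (by rw [hm]; exact card_partitionsInto_one_pos (by omega))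
          (by rwa [hm]) _ le_rfl
    _ ≤ P.card := by exact_mod_cast hx
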